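/- Let $n\ge 0$ and let $k_1<k_2<\dots<k_n$ be integers. A monotone triangle with $n$ rows is an array of integers $(a_{i,j})_{1\le i\le j\le n}$ such that $a_{i,j}\le a_{i+1,j+1}$ for $1\le i\le j<n$, $a_{i,j}\le a_{i-1,j}$ for $1<i\le j\le n$, and $a_{i,j}<a_{i,j+1}$ for $1\le i\le j\le n-1$; its bottom row is $(a_{1,1},a_{1,2},\dots,a_{1,n})$. Its $Q$-weight is $Q^{m}$, where $m$ is the number of entries $a_{i,j}$ with $2\le i\le j\le n$ and $a_{i-1,j-1}<a_{i,j}<a_{i-1,j}$. Here $Q$ is an indeterminate over $\mathbb{Q}$ or, more generally, any element of a commutative $\mathbb{Q}$-algebra. For a function $p$ of $(k_1,\dots,k_n)\in\mathbb{Z}^n$, let $E_{k_s}p$ be the function obtained by replacing $k_s$ with $k_s+1$; products of operators are compositions (all the operators below commute). Then there are finitely many monotone triangles with bottom row $(k_1,\dots,k_n)$, and the sum of their $Q$-weights equals the value at $(k_1,\dots,k_n)$ of $$\prod_{1\le s<t\le n}\bigl(\operatorname{id}-(2-Q)\,E_{k_s}+E_{k_s}E_{k_t}\bigr)\ \prod_{1\le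 i<j\le n}\frac{k_j-k_i}{j-i}.$$ -/

import Mathlib

/-- A monotone triangle with `n` rows.  Rows and diagonals are numbered from `0`: the entry
`entry i j` is defined for `i ≤ j < n`, row `0` is the bottom row (with `n` entries) and row `n - 1`
is the top row (with one entry).  The upper neighbours of `entry i j` are `entry (i + 1) j` (to the
left) and `entry (i + 1) (j + 1)` (to the right).  Outside the triangle `entry` is normalized to
`0`, so that two triangles are equal exactly when their entries are. -/
@[ext]
structure MonotoneTriangle (n : ℕ) where
  /-- The entries of the triangle. -/
  entry : ℕ → ℕ → ℤ
  /-- The entries increase weakly in northeast direction. -/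
  northeast : ∀ i j, i ≤ j → j + 1 < n → entry i j ≤ entry (i + 1) (j + 1)
  /-- The entries increase weakly in southeast direction. -/
  southeast : ∀ i j, i + 1 ≤ j → j < n → entry (i + 1) j ≤ entry i j
  /-- The entries increase strictly along rows. -/
  row_strict : ∀ i j, i ≤ j → j + 1 < n → entry i j < entry i (j + 1)
  /-- There is nothing outside the triangle. -/
  zeros : ∀ i j, ¬ (i ≤ j ∧ j < n) → entry i j = 0

namespace MonotoneTriangle

/-- The bottom row of a monotone triangle. -/
def bottomRow {n : ℕ} (T : MonotoneTriangle n) : Fin n → ℤ := fun j => T.entry 0 j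

/-- The number of entries, not in the bottom row, that lie strictly between their two lower
neighbours: `entry (i + 1) (j + 1)` has the lower neighbours `entry i j` and `entry i (j + 1)`. -/
def numStrictlyBetween {n : ℕ} (T : MonotoneTriangle n) : ℕ :=
  ((Finset.range n ×ˢ Finset.range n).filter fun p =>
    p.1 ≤ p.2 ∧ p.2 + 1 < n ∧
      T.entry p.1 p.2 < T.entry (p.1 + 1) (p.2 + 1) ∧
      T.entry (p.1 + 1) (p.2 + 1) < T.entry p.1 (p.2 + 1)).card

theorem entry_le_bottom {n : ℕ} (T : MonotoneTriangle n) (j : ℕ) (hj : j < n) :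
    ∀ i, i ≤ j → T.entry i j ≤ T.entry 0 j
  | 0, _ => le_rfl
  | i + 1, hi => (T.southeast i j hi hj).trans (entry_le_bottom T j hj i (by omega))

theorem bottom_le_entry {n : ℕ} (T : MonotoneTriangle n) (d : ℕ) :
    ∀ i, i + d < n → T.entry 0 d ≤ T.entry i (i + d)
  | 0, _ => by simp
  | i + 1, hi => by
    have h1 := bottom_le_entry T d i (by omega)
    have h2 := T.northeast i (i + d) (by omega) (by omega)
    have h3 : i + 1 + d = i + d + 1 := by omega
    rw [h3]
    exact h1.trans h2

/-- There are only finitely many monotone triangles with a given bottom row. -/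
theorem finite_bottomRow_eq {n : ℕ} (k : Fin n → ℤ) :
    {T : MonotoneTriangle n | T.bottomRow = k}.Finite := by
  let B : ℤ := ∑ j, |k j|
  have hB : ∀ j, |k j| ≤ B := fun j =>
    Finset.single_le_sum (f := fun j => |k j|) (fun _ _ => abs_nonneg _) (Finset.mem_univ j)
  have hB0 : 0 ≤ B := Finset.sum_nonneg fun _ _ => abs_nonneg _
  let φ : MonotoneTriangle n → Fin n → Fin n → ℤ := fun T i j => T.entry i j
  refine Set.Finite.of_finite_image (f := φ) ?_ ?_
  · refine Set.Finite.subset (Set.Finite.pi' (fun _ : Fin n => Set.Finite.pi' fun _ : Fin n =>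
      Set.finite_Icc (-B) B)) ?_
    rintro _ ⟨T, hT, rfl⟩ i j
    have hT' : ∀ l (hl : l < n), T.entry 0 l = k ⟨l, hl⟩ := fun l hl => congrFun hT ⟨l, hl⟩
    show T.entry i j ∈ Set.Icc (-B) B
    by_cases hij : (i : ℕ) ≤ j
    · have h1 := T.entry_le_bottom j j.2 i hij
      have h2 := T.bottom_le_entry (j - i) i (by omega)
      rw [Nat.add_sub_cancel' hij, hT' _ (by omega)] at h2
      rw [hT' _ j.2] at h1
      exact ⟨(abs_le.mp (hB _)).1.trans h2, h1.trans (abs_le.mp (hB _)).2⟩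
    · rw [T.zeros i j (fun h => hij h.1)]
      exact ⟨by omega, hB0⟩
  · intro T _ T' _ h
    ext i j
    by_cases hij : i ≤ j ∧ j < n
    · exact congrFun (congrFun h ⟨i, by omega⟩) ⟨j, hij.2⟩
    · rw [T.zeros i j hij, T'.zeros i j hij]

/-- The set of monotone triangles with bottom row `k`. -/
noncomputable def withBottomRow {n : ℕ} (k : Fin n → ℤ) : Finset (MonotoneTriangle n) :=
  (finite_bottomRow_eq k).toFinset

/-- The generating function of the monotone triangles with bottom row `k` with respect to the
`Q`-weight, which is `Q` to the number of entries strictly between their two lower neighbours. -/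
noncomputable def generatingFunction {R : Type*} [CommRing R] (Q : R) {n : ℕ} (k : Fin n → ℤ) : R :=
  ∑ T ∈ withBottomRow k, Q ^ T.numStrictlyBetween

end MonotoneTriangle

/-- The shift operator with respect to the variable `k_s`, acting on functions of
`(k_1, …, k_n)`: it replaces `k_s` by `k_s + 1`. -/
def shiftOp (R : Type*) [CommRing R] {n : ℕ} (s : Fin n) : Module.End R ((Fin n → ℤ) → R) where
  toFun f := fun k => f (k + Pi.single s 1)
  map_add' _ _ := rfl
  map_smul' _ _ := rfl

/-- The operator `id - (2 - Q) E_{k_s} + E_{k_s} E_{k_t}`; the product of operators is their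
composition. -/
def pairOp {R : Type*} [CommRing R] (Q : R) {n : ℕ} (s t : Fin n) :
    Module.End R ((Fin n → ℤ) → R) :=
  1 - (2 - Q) • shiftOp R s + shiftOp R s * shiftOp R t

theorem shiftOp_commute {R : Type*} [CommRing R] {n : ℕ} (s t : Fin n) :
    Commute (shiftOp R s) (shiftOp R t) := by
  refine LinearMap.ext fun f => funext fun k => ?_
  show f (k + Pi.single s 1 + Pi.single t 1) = f (k + Pi.single t 1 + Pi.single s 1)
  rw [add_right_comm]

theorem pairOp_commute {R : Type*} [CommRing R] (Q : R) {n : ℕ} (s t s' t' : Fin n) :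
    Commute (pairOp Q s t) (pairOp Q s' t') := by
  have key : ∀ A : Module.End R ((Fin n → ℤ) → R), (∀ u, Commute A (shiftOp R u)) →
      ∀ u v : Fin n, Commute A (pairOp Q u v) := fun A hA u v =>
    ((Commute.one_right A).sub_right ((hA u).smul_right _)).add_right ((hA u).mul_right (hA v))
  exact key _ (fun u => (key _ (fun v => shiftOp_commute u v) s t).symm) s' t'

/-- The product of the operators `id - (2 - Q) E_{k_s} + E_{k_s} E_{k_t}` over all pairs `s < t`,
that is, their composition in any order. -/
noncomputable def operatorProduct {R : Type*} [CommRing R] (Q : R) (n : ℕ) :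
    Module.End R ((Fin n → ℤ) → R) :=
  (Finset.univ.filter fun p : Fin n × Fin n => p.1 < p.2).noncommProd (fun p => pairOp Q p.1 p.2)
    (fun p _ q _ _ => pairOp_commute Q p.1 p.2 q.1 q.2)

/-- The function `(k_1, …, k_n) ↦ ∏_{i < j} (k_j - k_i) / (j - i)`, with its rational values read
in the `ℚ`-algebra `R`. -/
def vandermondeQuotient (R : Type*) [CommRing R] [Algebra ℚ R] (n : ℕ) : (Fin n → ℤ) → R :=
  fun k => ∏ p : Fin n × Fin n with p.1 < p.2,
    algebraMap ℚ R (((k p.2 : ℚ) - (k p.1 : ℚ)) / (((p.2 : ℕ) : ℚ) - ((p.1 : ℕ) : ℚ)))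

/-!
The generating function for the bottom row `k` is the weighted sum, over the rows `l` that may stand
above `k`, of the generating function for the bottom row `l`, so that the theorem follows by
induction once this summation is understood on functions of the form `∏ pairOp` applied to
`det (k_i choose j)`, the determinant that the quotient of Vandermonde determinants equals.

All operators are polynomials in the shifts `E_i`. Raising the lower indices of the binomial
coefficients by one inverts `∏ (E_i - id)`, so the summation over `l` telescopes in every variable.
What remains are the operators `E - (1 - Q) id` and `id - (1 - Q) E` at the two ends of the range of
each `l_i`, and a correction for `l_i = l_{i+1}`, which must not occur. The identity
`(E_i - (1 - Q) id) (id - (1 - Q) E_{i+1}) + (E_i - id) (E_{i+1} - id) = Q pairOp_{i+1,i}`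
shows that the correction cancels the mixed boundary terms: `pairOp_{i+1,i} ∏ pairOp` is symmetric
in `E_i` and `E_{i+1}`, whereas the determinant is alternating, so the right-hand side contributes
nothing where the two variables agree.

The surviving terms form an alternating sum over an omitted variable `k_p`. It is the expansion of
`det (k_i choose j)` along its row of ones, because `E_p` acts as the identity on the minor without
`k_p`, where the factors of `∏ pairOp` involving `p` become the boundary operators.
-/

section ShiftOperators

open MvPolynomial

variable {R : Type*} [CommRing R] {m n : ℕ}

/-- The action of polynomials on functions of `(k_1, …, k_n)` in which the variable `X s` acts as
the shift operator `E_{k_s}`.  Identities between products of the (commuting) operators thus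
become identities in a polynomial ring. -/
noncomputable def shiftAction (R : Type*) [CommRing R] (n : ℕ) :
    MvPolynomial (Fin n) R →ₐ[R] Module.End R ((Fin n → ℤ) → R) :=
  AddMonoidAlgebra.lift R _ _
    { toFun := fun m => LinearMap.funLeft R R fun k i => k i + m.toAdd i
      map_one' := by ext; simp [LinearMap.funLeft_apply]
      map_mul' := fun a b => by ext; simp [LinearMap.funLeft_apply, add_assoc] }

theorem shiftAction_apply (P : MvPolynomial (Fin n) R) (f : (Fin n → ℤ) → R) (k : Fin n → ℤ) :
    shiftAction R n P f k = ∑ m ∈ P.support, P.coeff m * f fun i => k i + m i := by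
  rw [shiftAction, AddMonoidAlgebra.lift_apply, Finsupp.sum, LinearMap.sum_apply, Finset.sum_apply]
  rfl

@[simp]
theorem shiftAction_X (s : Fin n) : shiftAction R n (X s) = shiftOp R s := by
  ext f k
  rw [X, shiftAction, monomial, AddMonoidAlgebra.lsingle_apply, AddMonoidAlgebra.lift_single,
    one_smul]
  refine congrArg f (funext fun i => ?_)
  simp [Finsupp.single_apply, Pi.single_apply, eq_comm]

@[simp]
theorem shiftAction_C (c : R) : shiftAction R n (C c) = c • 1 := by
  rw [← algebraMap_eq, AlgHom.commutes, Algebra.algebraMap_eq_smul_one]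

theorem shiftAction_intertwine (L : ((Fin m → ℤ) → R) →ₗ[R] ((Fin n → ℤ) → R))
    (q : Fin n → MvPolynomial (Fin m) R)
    (h : ∀ s f, shiftOp R s (L f) = L (shiftAction R m (q s) f))
    (P : MvPolynomial (Fin n) R) (f : (Fin m → ℤ) → R) :
    shiftAction R n P (L f) = L (shiftAction R m (aeval q P) f) := by
  induction P using MvPolynomial.induction_on generalizing f with
  | C c => simp
  | add P₁ P₂ h₁ h₂ => simp [h₁, h₂]
  | mul_X P s hP =>
    simp only [map_mul, shiftAction_X, Module.End.mul_apply, h, hP, aeval_X]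

/-- The transposition pairs off terms of opposite value; in a term that it fixes, `f` is evaluated
where the variables `k_i` and `k_j` agree. -/
theorem shiftAction_apply_eq_zero_of_swap {i j : Fin n} {P : MvPolynomial (Fin n) R}
    (hP : rename (Equiv.swap i j) P = P) {f : (Fin n → ℤ) → R}
    (hf : ∀ k, f (k ∘ Equiv.swap i j) = -f k) (hf₀ : ∀ k, k i = k j → f k = 0)
    {k : Fin n → ℤ} (hk : k i = k j) : shiftAction R n P f k = 0 := by
  have hk' : ∀ s, k (Equiv.swap i j s) = k s := fun s => by
    rw [Equiv.swap_apply_def]; split_ifs <;> simp_all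
  have hcoeff (m : Fin n →₀ ℕ) : P.coeff (m.mapDomain (Equiv.swap i j)) = P.coeff m := by
    conv_lhs => rw [← hP]
    exact coeff_rename_mapDomain _ (Equiv.injective _) _ _
  have happly (m : Fin n →₀ ℕ) (s : Fin n) :
      m.mapDomain (Equiv.swap i j) s = m (Equiv.swap i j s) := by
    rw [← Finsupp.equivMapDomain_eq_mapDomain, Finsupp.equivMapDomain_apply, Equiv.symm_swap]
  have hshift (m : Fin n →₀ ℕ) : (fun s => k s + m.mapDomain (Equiv.swap i j) s) =
      (fun s => k s + (m s : ℤ)) ∘ Equiv.swap i j := by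
    funext s
    simp only [Function.comp_apply, hk', happly]
  rw [shiftAction_apply]
  refine Finset.sum_involution (fun m _ => m.mapDomain (Equiv.swap i j)) ?_ ?_ ?_ ?_
  · intro m _
    rw [hcoeff, hshift, hf, mul_neg, add_neg_cancel]
  · intro m _ hne hfix
    refine hne (mul_eq_zero_of_right _ (hf₀ _ ?_))
    have hm := happly m j
    rw [hfix, Equiv.swap_apply_right] at hm
    rw [hk, hm]
  · intro m hm
    rwa [mem_support_iff, hcoeff, ← mem_support_iff]
  · intro m _
    ext s
    simp [happly]

/-- The polynomial in the shift operators that is `pairOp`. -/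
noncomputable def pairPoly (Q : R) (s t : Fin n) : MvPolynomial (Fin n) R :=
  1 - C (2 - Q) * X s + X s * X t

/-- The polynomial in the shift operators that is `operatorProduct`. -/
noncomputable def pairProd (Q : R) (n : ℕ) : MvPolynomial (Fin n) R :=
  ∏ p : Fin n × Fin n with p.1 < p.2, pairPoly Q p.1 p.2

theorem shiftAction_pairPoly (Q : R) (s t : Fin n) :
    shiftAction R n (pairPoly Q s t) = pairOp Q s t := by
  rw [pairPoly, pairOp, map_add, map_sub, map_mul, map_mul, shiftAction_C]
  simp

theorem shiftAction_pairProd (Q : R) (n : ℕ) :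
    shiftAction R n (pairProd Q n) = operatorProduct Q n := by
  have hmap := Finset.map_noncommProd {p : Fin n × Fin n | p.1 < p.2}
    (fun p => pairPoly Q p.1 p.2) (fun _ _ _ _ _ => Commute.all _ _) (shiftAction R n)
  rw [Finset.noncommProd_eq_prod] at hmap
  rw [pairProd, hmap]
  exact Finset.noncommProd_congr rfl (fun p _ => shiftAction_pairPoly Q p.1 p.2) _

theorem rename_pairPoly (Q : R) (σ : Fin m → Fin n) (s t : Fin m) :
    rename σ (pairPoly Q s t) = pairPoly Q (σ s) (σ t) := by
  simp [pairPoly]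

theorem pairProd_eq_prod_prod (Q : R) (n : ℕ) :
    pairProd Q n = ∏ s, ∏ t, if s < t then pairPoly Q s t else 1 := by
  rw [pairProd, Finset.prod_filter, ← Finset.univ_product_univ, Finset.prod_product]

/-- The factors are permuted: the transposition of neighbours preserves the order of all other
pairs. -/
theorem rename_swap_pairPoly_mul_pairProd (Q : R) {i j : Fin n} (hij : (j : ℕ) = i + 1) :
    rename (Equiv.swap i j) (pairPoly Q j i * pairProd Q n) = pairPoly Q j i * pairProd Q n := by
  have hprod : pairPoly Q j i * pairProd Q n =
      ∏ p : Fin n × Fin n with p.1 < p.2 ∨ p = (j, i), pairPoly Q p.1 p.2 := by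
    have hji : ¬ j < i := by rw [Fin.lt_def]; omega
    rw [Finset.filter_or, Finset.filter_eq', if_pos (Finset.mem_univ _), Finset.union_comm,
      ← Finset.insert_eq, Finset.prod_insert (by simpa using hji), pairProd]
  rw [hprod, map_prod]
  refine Finset.prod_equiv ((Equiv.swap i j).prodCongr (Equiv.swap i j)) ?_
    fun p _ => rename_pairPoly Q _ _ _
  rintro ⟨s, t⟩
  simp only [Finset.mem_filter_univ, Equiv.prodCongr_apply, Prod.map_apply, Prod.mk.injEq,
    Equiv.swap_apply_def, Fin.lt_def, Fin.ext_iff]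
  split_ifs <;> omega

/-- The polynomial of the operator `id - (1 - Q) E_{k_s}`. -/
noncomputable def leftEdgePoly (Q : R) (s : Fin n) : MvPolynomial (Fin n) R :=
  1 - C (1 - Q) * X s

/-- The polynomial of the operator `E_{k_s} - (1 - Q) id`. -/
noncomputable def rightEdgePoly (Q : R) (s : Fin n) : MvPolynomial (Fin n) R :=
  X s - C (1 - Q)

/-- The product of the operators as which the factors of `operatorProduct` that involve `k_p` act
on functions that do not depend on `k_p`, the remaining variables being numbered by `Fin n`. -/
noncomputable def edgeProd (Q : R) (p : Fin (n + 1)) : MvPolynomial (Fin n) R :=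
  ∏ i, if i.castSucc < p then leftEdgePoly Q i else rightEdgePoly Q i

theorem aeval_insertNth_one_pairProd (Q : R) (p : Fin (n + 1)) :
    aeval (p.insertNth 1 X : Fin (n + 1) → MvPolynomial (Fin n) R) (pairProd Q (n + 1)) =
      edgeProd Q p * pairProd Q n := by
  have hC : (C 2 : MvPolynomial (Fin n) R) = 2 := map_ofNat C 2
  have hleft (i : Fin n) : aeval (p.insertNth 1 X : _ → MvPolynomial (Fin n) R)
      (pairPoly Q (p.succAbove i) p) = leftEdgePoly Q i := by
    simp [pairPoly, leftEdgePoly]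
    linear_combination (-X i) * hC
  have hright (i : Fin n) : aeval (p.insertNth 1 X : _ → MvPolynomial (Fin n) R)
      (pairPoly Q p (p.succAbove i)) = rightEdgePoly Q i := by
    simp [pairPoly, rightEdgePoly]
    linear_combination -hC
  have hrest (i j : Fin n) : aeval (p.insertNth 1 X : _ → MvPolynomial (Fin n) R)
      (pairPoly Q (p.succAbove i) (p.succAbove j)) = pairPoly Q i j := by
    simp [pairPoly]
  simp only [pairProd_eq_prod_prod, edgeProd, Fin.prod_univ_succAbove _ p, map_mul, map_prod,
    apply_ite (aeval _), map_one, hleft, hright, hrest, lt_self_iff_false, if_false, one_mul,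
    Fin.succAbove_lt_succAbove_iff, Fin.succAbove_lt_iff_castSucc_lt,
    Fin.lt_succAbove_iff_le_castSucc, Finset.prod_mul_distrib]
  rw [← mul_assoc, ← Finset.prod_mul_distrib]
  congr 1
  refine Finset.prod_congr rfl fun i _ => ?_
  rcases lt_or_ge i.castSucc p with h | h
  · simp [h, h.not_ge]
  · simp [h, h.not_gt]

/-- The operator that omits the variable `k_p`: it turns a function of `n` variables into one of
`n + 1` variables that does not depend on `k_p`. -/
def omitVar (p : Fin (n + 1)) : ((Fin n → ℤ) → R) →ₗ[R] ((Fin (n + 1) → ℤ) → R) :=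
  LinearMap.funLeft R R p.removeNth

theorem shiftAction_omitVar (p : Fin (n + 1)) (P : MvPolynomial (Fin (n + 1)) R)
    (f : (Fin n → ℤ) → R) :
    shiftAction R (n + 1) P (omitVar p f) =
      omitVar p (shiftAction R n (aeval (p.insertNth 1 X : Fin (n + 1) → _) P) f) := by
  refine shiftAction_intertwine _ _ (fun s f => funext fun k => ?_) P f
  cases s using p.succAboveCases with
  | x =>
    rw [Fin.insertNth_apply_same, map_one]
    refine congrArg f (funext fun i => ?_)
    simp [Fin.removeNth_apply]
  | p i =>
    rw [Fin.insertNth_apply_succAbove, shiftAction_X]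
    refine congrArg f (funext fun j => ?_)
    simp [Fin.removeNth_apply, Pi.single_apply]

/-- The product of the difference operators `E_{k_i} - id` as a polynomial. -/
noncomputable def diffProd (R : Type*) [CommRing R] (n : ℕ) : MvPolynomial (Fin n) R :=
  ∏ i, (X i - 1)

/-- The operator that fixes the first variable to be `x`. -/
def evalHead (x : ℤ) : ((Fin (n + 1) → ℤ) → R) →ₗ[R] ((Fin n → ℤ) → R) :=
  LinearMap.funLeft R R fun l : Fin n → ℤ => (Fin.cons x l : Fin (n + 1) → ℤ)

theorem evalHead_apply (x : ℤ) (f : (Fin (n + 1) → ℤ) → R) (l : Fin n → ℤ) :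
    evalHead x f l = f (Fin.cons x l) := rfl

theorem evalHead_head_apply_tail (f : (Fin (n + 1) → ℤ) → R) (k : Fin (n + 1) → ℤ) :
    evalHead (k 0) f (Fin.tail k) = f k := by
  rw [evalHead_apply, Fin.cons_self_tail]

theorem evalHead_shiftOp_zero (x : ℤ) (f : (Fin (n + 1) → ℤ) → R) :
    evalHead x (shiftOp R 0 f) = evalHead (x + 1) f := by
  funext l
  refine congrArg f (funext fun i => ?_)
  cases i using Fin.cases <;> simp

theorem evalHead_shiftOp_succ (x : ℤ) (s : Fin n) (f : (Fin (n + 1) → ℤ) → R) :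
    evalHead x (shiftOp R s.succ f) = shiftOp R s (evalHead x f) := by
  funext l
  refine congrArg f (funext fun i => ?_)
  cases i using Fin.cases <;> simp [Pi.single_apply]

theorem evalHead_shiftAction_rename_succ (x : ℤ) (P : MvPolynomial (Fin n) R)
    (f : (Fin (n + 1) → ℤ) → R) :
    evalHead x (shiftAction R (n + 1) (rename Fin.succ P) f) =
      shiftAction R n P (evalHead x f) := by
  rw [rename_eq_aeval]
  exact (shiftAction_intertwine (evalHead x) (X ∘ Fin.succ)
    (fun s f => by rw [Function.comp_apply, shiftAction_X, evalHead_shiftOp_succ]) P f).symm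

/-- The difference operator in the first variable, at `x`. -/
def headDiff (x : ℤ) : ((Fin (n + 1) → ℤ) → R) →ₗ[R] ((Fin n → ℤ) → R) :=
  evalHead (x + 1) - evalHead x

/-- The operator `id - (1 - Q) E` in the first variable, at `x`. -/
def leftEdge (Q : R) (x : ℤ) : ((Fin (n + 1) → ℤ) → R) →ₗ[R] ((Fin n → ℤ) → R) :=
  evalHead x - (1 - Q) • evalHead (x + 1)

/-- The operator `E - (1 - Q) id` in the first variable, at `x`. -/
def rightEdge (Q : R) (x : ℤ) : ((Fin (n + 1) → ℤ) → R) →ₗ[R] ((Fin n → ℤ) → R) :=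
  evalHead (x + 1) - (1 - Q) • evalHead x

theorem evalHead_shiftAction_diffProd (x : ℤ) (f : (Fin (n + 1) → ℤ) → R) :
    evalHead x (shiftAction R (n + 1) (diffProd R (n + 1)) f) =
      shiftAction R n (diffProd R n) (headDiff x f) := by
  have hsplit : diffProd R (n + 1) = rename Fin.succ (diffProd R n) * (X 0 - 1) := by
    simp [diffProd, Fin.prod_univ_succ, mul_comm]
  rw [hsplit, map_mul, Module.End.mul_apply, evalHead_shiftAction_rename_succ]
  simp [evalHead_shiftOp_zero, headDiff]

theorem evalHead_shiftAction_rename_succ_mul_leftEdgePoly (Q : R) (x : ℤ)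
    (P : MvPolynomial (Fin n) R) (f : (Fin (n + 1) → ℤ) → R) :
    evalHead x (shiftAction R (n + 1) (rename Fin.succ P * leftEdgePoly Q 0) f) =
      shiftAction R n P (leftEdge Q x f) := by
  rw [map_mul, Module.End.mul_apply, evalHead_shiftAction_rename_succ]
  simp [leftEdgePoly, leftEdge, evalHead_shiftOp_zero, sub_smul]

theorem evalHead_shiftAction_rename_succ_mul_rightEdgePoly (Q : R) (x : ℤ)
    (P : MvPolynomial (Fin n) R) (f : (Fin (n + 1) → ℤ) → R) :
    evalHead x (shiftAction R (n + 1) (rename Fin.succ P * rightEdgePoly Q 0) f) =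
      shiftAction R n P (rightEdge Q x f) := by
  rw [map_mul, Module.End.mul_apply, evalHead_shiftAction_rename_succ]
  simp [rightEdgePoly, rightEdge, evalHead_shiftOp_zero, sub_smul]

theorem leftEdge_rightEdge_add_headDiff_headDiff (Q : R) (x : ℤ)
    (f : (Fin (n + 2) → ℤ) → R) :
    leftEdge Q x (rightEdge Q x f) + headDiff x (headDiff x f) =
      Q • evalHead x (evalHead x (pairOp Q 1 0 f)) := by
  simp only [← Fin.succ_zero_eq_one, leftEdge, rightEdge, headDiff, pairOp, LinearMap.add_apply,
    LinearMap.sub_apply, LinearMap.smul_apply, Module.End.one_apply, Module.End.mul_apply, map_add,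
    map_sub, map_smul, evalHead_shiftOp_succ, evalHead_shiftOp_zero]
  module

/-- The functions `f` such that `pairOp Q j i f` vanishes wherever the neighbouring variables `k_i`
and `k_j`, where `j = i + 1`, agree. -/
def diagonalKernel (Q : R) (n : ℕ) : Submodule R ((Fin n → ℤ) → R) where
  carrier := {f | ∀ i j : Fin n, (j : ℕ) = i + 1 → ∀ l, l i = l j → pairOp Q j i f l = 0}
  zero_mem' := fun i j _ l _ => by rw [map_zero, Pi.zero_apply]
  add_mem' := fun hf hg i j h l hl => by
    rw [map_add, Pi.add_apply, hf i j h l hl, hg i j h l hl, add_zero]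
  smul_mem' := fun c f hf i j h l hl => by
    rw [map_smul, Pi.smul_apply, hf i j h l hl, smul_zero]

section DiagonalKernel

variable {Q : R} {f : (Fin (n + 1) → ℤ) → R}

theorem evalHead_mem_diagonalKernel (hf : f ∈ diagonalKernel Q (n + 1)) (x : ℤ) :
    evalHead x f ∈ diagonalKernel Q n := fun i j h l hl => by
  rw [← shiftAction_pairPoly, ← evalHead_shiftAction_rename_succ, rename_pairPoly,
    shiftAction_pairPoly]
  exact hf i.succ j.succ (by simp [h]) (Fin.cons x l) (by simpa using hl)

theorem headDiff_mem_diagonalKernel (hf : f ∈ diagonalKernel Q (n + 1)) (x : ℤ) :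
    headDiff x f ∈ diagonalKernel Q n :=
  sub_mem (evalHead_mem_diagonalKernel hf _) (evalHead_mem_diagonalKernel hf _)

theorem leftEdge_mem_diagonalKernel (hf : f ∈ diagonalKernel Q (n + 1)) (x : ℤ) :
    leftEdge Q x f ∈ diagonalKernel Q n :=
  sub_mem (evalHead_mem_diagonalKernel hf _)
    (Submodule.smul_mem _ _ (evalHead_mem_diagonalKernel hf _))

theorem rightEdge_mem_diagonalKernel (hf : f ∈ diagonalKernel Q (n + 1)) (x : ℤ) :
    rightEdge Q x f ∈ diagonalKernel Q n :=
  sub_mem (evalHead_mem_diagonalKernel hf _)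
    (Submodule.smul_mem _ _ (evalHead_mem_diagonalKernel hf _))

theorem leftEdge_rightEdge_of_mem_diagonalKernel {f : (Fin (n + 2) → ℤ) → R}
    (hf : f ∈ diagonalKernel Q (n + 2)) (x : ℤ) :
    leftEdge Q x (rightEdge Q x f) = -headDiff x (headDiff x f) := by
  rw [← add_eq_zero_iff_eq_neg, leftEdge_rightEdge_add_headDiff_headDiff]
  refine smul_eq_zero_of_right Q (funext fun l => ?_)
  exact hf 0 1 (by simp) (Fin.cons x (Fin.cons x l)) (by simp)

end DiagonalKernel

end ShiftOperators

section InterlacingRows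

open MvPolynomial

variable {R : Type*} [CommRing R] {n : ℕ}

open scoped Classical in
/-- The strictly increasing rows that may stand above the row `k` in a monotone triangle. -/
noncomputable def interlacingRows (k : Fin (n + 1) → ℤ) : Finset (Fin n → ℤ) :=
  {l ∈ Fintype.piFinset fun i => Finset.Icc (k i.castSucc) (k i.succ) | StrictMono l}

theorem mem_interlacingRows {k : Fin (n + 1) → ℤ} {l : Fin n → ℤ} :
    l ∈ interlacingRows k ↔ (∀ i, k i.castSucc ≤ l i ∧ l i ≤ k i.succ) ∧ StrictMono l := by
  simp [interlacingRows]

theorem strictMono_tail {α : Type*} [Preorder α] {k : Fin (n + 1) → α} (hk : StrictMono k) :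
    StrictMono (Fin.tail k) :=
  hk.comp Fin.strictMono_succ

theorem strictMono_cons_iff {α : Type*} [Preorder α] {x : α} {l : Fin (n + 1) → α} :
    StrictMono (Fin.cons x l : Fin (n + 2) → α) ↔ x < l 0 ∧ StrictMono l :=
  strictMono_vecCons

theorem cons_mem_interlacingRows {k : Fin (n + 2) → ℤ} {x : ℤ} {l : Fin n → ℤ} :
    (Fin.cons x l : Fin (n + 1) → ℤ) ∈ interlacingRows k ↔
      (x ∈ Finset.Icc (k 0) (k 1) ∧ l ∈ interlacingRows (Fin.tail k)) ∧
        StrictMono (Fin.cons x l : Fin (n + 1) → ℤ) := by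
  have htail (h : StrictMono (Fin.cons x l : Fin (n + 1) → ℤ)) : StrictMono l := by
    simpa using strictMono_tail h
  simp only [mem_interlacingRows, Fin.forall_fin_succ, Fin.cons_zero, Fin.cons_succ,
    Finset.mem_Icc, Fin.tail, Fin.castSucc_zero, Fin.succ_zero_eq_one, ← Fin.succ_castSucc]
  tauto

theorem tail_mem_interlacingRows {k : Fin (n + 2) → ℤ} {l : Fin (n + 1) → ℤ}
    (hl : l ∈ interlacingRows k) : Fin.tail l ∈ interlacingRows (Fin.tail k) := by
  rw [← Fin.cons_self_tail l, cons_mem_interlacingRows] at hl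
  exact hl.1.2

theorem cons_head_mem_interlacingRows {k : Fin (n + 2) → ℤ} (hk : StrictMono k) {l : Fin n → ℤ}
    (hl : l ∈ interlacingRows (Fin.tail k)) :
    (Fin.cons (k 0) l : Fin (n + 1) → ℤ) ∈ interlacingRows k := by
  have hk01 : k 0 < k 1 := hk Fin.zero_lt_one
  refine cons_mem_interlacingRows.2 ⟨⟨Finset.left_mem_Icc.2 hk01.le, hl⟩, ?_⟩
  obtain ⟨hbound, hl⟩ := mem_interlacingRows.1 hl
  cases n with
  | zero => exact Subsingleton.strictMono (α := Fin 1) _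
  | succ n => exact strictMono_cons_iff.2 ⟨hk01.trans_le (hbound 0).1, hl⟩

theorem not_strictMono_cons_iff_of_mem_interlacingRows {k : Fin (n + 2) → ℤ} {x : ℤ}
    (hx : x ≤ k 0) {l : Fin (n + 1) → ℤ} (hl : l ∈ interlacingRows k) :
    ¬ StrictMono (Fin.cons x l : Fin (n + 2) → ℤ) ↔ x = k 0 ∧ l 0 = k 0 := by
  obtain ⟨hbound, hl⟩ := mem_interlacingRows.1 hl
  have hl₀ : k 0 ≤ l 0 := (hbound 0).1
  rw [strictMono_cons_iff, and_iff_left hl]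
  omega

/-- The weight of an entry `x` with lower neighbours `a` and `b`. -/
def entryWeight (Q : R) (a b x : ℤ) : R := if a < x ∧ x < b then Q else 1

theorem entryWeight_left (Q : R) (a b : ℤ) : entryWeight Q a b a = 1 := by
  simp [entryWeight]

theorem entryWeight_right (Q : R) (a b : ℤ) : entryWeight Q a b b = 1 := by
  simp [entryWeight]

/-- The weight of a row `l` above the row `k`. -/
def rowWeight (Q : R) (k : Fin (n + 1) → ℤ) (l : Fin n → ℤ) : R :=
  ∏ i, entryWeight Q (k i.castSucc) (k i.succ) (l i)

theorem rowWeight_cons (Q : R) (k : Fin (n + 2) → ℤ) (x : ℤ) (l : Fin n → ℤ) :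
    rowWeight Q k (Fin.cons x l) = entryWeight Q (k 0) (k 1) x * rowWeight Q (Fin.tail k) l := by
  simp [rowWeight, Fin.prod_univ_succ, Fin.tail]

/-- The weighted sum of a function over the rows that may stand above `k`. -/
noncomputable def rowSum (Q : R) (k : Fin (n + 1) → ℤ) : ((Fin n → ℤ) → R) →ₗ[R] R :=
  ∑ l ∈ interlacingRows k, rowWeight Q k l • LinearMap.proj l

theorem rowSum_apply (Q : R) (k : Fin (n + 1) → ℤ) (F : (Fin n → ℤ) → R) :
    rowSum Q k F = ∑ l ∈ interlacingRows k, rowWeight Q k l * F l := by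
  simp [rowSum]

theorem rowSum_congr (Q : R) (k : Fin (n + 1) → ℤ) {F G : (Fin n → ℤ) → R}
    (h : ∀ l, StrictMono l → F l = G l) : rowSum Q k F = rowSum Q k G := by
  rw [rowSum_apply, rowSum_apply]
  exact Finset.sum_congr rfl fun l hl => by rw [h l (mem_interlacingRows.1 hl).2]

theorem rowSum_zero (Q : R) (k : Fin 1 → ℤ) (F : (Fin 0 → ℤ) → R) (l : Fin 0 → ℤ) :
    rowSum Q k F = F l := by
  have hrows : interlacingRows k = {l} := by
    ext l'
    simp [mem_interlacingRows, Subsingleton.elim l' l, Subsingleton.strictMono]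
  simp [rowSum_apply, hrows, rowWeight]

open scoped Classical in
theorem rowSum_succ (Q : R) (k : Fin (n + 2) → ℤ) (F : (Fin (n + 1) → ℤ) → R) :
    rowSum Q k F = ∑ p ∈ Finset.Icc (k 0) (k 1) ×ˢ interlacingRows (Fin.tail k) with
        StrictMono (Fin.cons p.1 p.2 : Fin (n + 1) → ℤ),
      entryWeight Q (k 0) (k 1) p.1 * (rowWeight Q (Fin.tail k) p.2 * evalHead p.1 F p.2) := by
  rw [rowSum_apply]
  refine Finset.sum_equiv (Fin.consEquiv fun _ => ℤ).symm (fun l => ?_) fun l _ => ?_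
  · obtain ⟨⟨x, l⟩, rfl⟩ := (Fin.consEquiv fun _ => ℤ).surjective l
    rw [Equiv.symm_apply_apply, Finset.mem_filter, Finset.mem_product]
    exact cons_mem_interlacingRows
  · obtain ⟨⟨x, l⟩, rfl⟩ := (Fin.consEquiv fun _ => ℤ).surjective l
    rw [Equiv.symm_apply_apply, ← mul_assoc, ← rowWeight_cons]
    rfl

theorem sum_entryWeight_mul_rowSum_eq_sum_product (Q : R) (k : Fin (n + 2) → ℤ)
    (F : (Fin (n + 1) → ℤ) → R) :
    ∑ x ∈ Finset.Icc (k 0) (k 1),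
        entryWeight Q (k 0) (k 1) x * rowSum Q (Fin.tail k) (evalHead x F) =
      ∑ p ∈ Finset.Icc (k 0) (k 1) ×ˢ interlacingRows (Fin.tail k),
        entryWeight Q (k 0) (k 1) p.1 * (rowWeight Q (Fin.tail k) p.2 * evalHead p.1 F p.2) := by
  simp only [rowSum_apply, Finset.mul_sum, Finset.sum_product]

theorem rowSum_one (Q : R) (k : Fin 2 → ℤ) (F : (Fin 1 → ℤ) → R) :
    rowSum Q k F = ∑ x ∈ Finset.Icc (k 0) (k 1),
      entryWeight Q (k 0) (k 1) x * rowSum Q (Fin.tail k) (evalHead x F) := by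
  rw [rowSum_succ, sum_entryWeight_mul_rowSum_eq_sum_product,
    Finset.filter_true_of_mem fun _ _ => Subsingleton.strictMono (α := Fin 1) _]

open scoped Classical in
theorem sum_product_interlacingRows_not_strictMono {M : Type*} [AddCommMonoid M]
    {k : Fin (n + 3) → ℤ} (hk : StrictMono k) (g : ℤ × (Fin (n + 1) → ℤ) → M) :
    ∑ p ∈ Finset.Icc (k 0) (k 1) ×ˢ interlacingRows (Fin.tail k) with
        ¬ StrictMono (Fin.cons p.1 p.2 : Fin (n + 2) → ℤ), g p =
      ∑ l ∈ interlacingRows (Fin.tail (Fin.tail k)), g (k 1, Fin.cons (k 1) l) := by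
  refine (Finset.sum_nbij' (fun l => (k 1, (Fin.cons (k 1) l : Fin (n + 1) → ℤ)))
    (fun p => Fin.tail p.2) (fun l hl => ?_) (fun p hp => ?_) (fun l _ => Fin.tail_cons _ _)
    (fun p hp => ?_) fun _ _ => rfl).symm
  · have hrow : (Fin.cons (k 1) l : Fin (n + 1) → ℤ) ∈ interlacingRows (Fin.tail k) :=
      cons_head_mem_interlacingRows (strictMono_tail hk) hl
    rw [Finset.mem_filter, Finset.mem_product, Finset.mem_Icc]
    exact ⟨⟨⟨(hk Fin.zero_lt_one).le, le_rfl⟩, hrow⟩,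
      (not_strictMono_cons_iff_of_mem_interlacingRows le_rfl hrow).2 ⟨rfl, rfl⟩⟩
  · rw [Finset.mem_filter, Finset.mem_product] at hp
    exact tail_mem_interlacingRows hp.1.2
  · obtain ⟨x, l⟩ := p
    rw [Finset.mem_filter, Finset.mem_product, Finset.mem_Icc] at hp
    obtain ⟨⟨⟨-, hx⟩, hl⟩, hnot⟩ := hp
    obtain ⟨hx₁, hl₁⟩ := (not_strictMono_cons_iff_of_mem_interlacingRows hx hl).1 hnot
    have hx' : k 1 = x := hx₁.symm
    have hl' : k 1 = l 0 := hl₁.symm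
    exact Prod.ext hx' (by rw [hl', Fin.cons_self_tail])

/-- An entry between `k 0` and `k 1` and a row above `Fin.tail k` form a row above `k` unless both
of them begin with `k 1`, whence the correction term. -/
theorem rowSum_succ_succ (Q : R) {k : Fin (n + 3) → ℤ} (hk : StrictMono k)
    (F : (Fin (n + 2) → ℤ) → R) :
    rowSum Q k F = ∑ x ∈ Finset.Icc (k 0) (k 1),
        entryWeight Q (k 0) (k 1) x * rowSum Q (Fin.tail k) (evalHead x F) -
      rowSum Q (Fin.tail (Fin.tail k)) (evalHead (k 1) (evalHead (k 1) F)) := by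
  classical
  have hweight (l : Fin n → ℤ) : rowWeight Q (Fin.tail k) (Fin.cons (k 1) l) =
      rowWeight Q (Fin.tail (Fin.tail k)) l := by
    rw [rowWeight_cons]
    exact (congrArg (· * _) (entryWeight_left Q _ _)).trans (one_mul _)
  rw [sum_entryWeight_mul_rowSum_eq_sum_product, ← Finset.sum_filter_add_sum_filter_not _
    fun p => StrictMono (Fin.cons p.1 p.2 : Fin (n + 2) → ℤ), ← rowSum_succ,
    sum_product_interlacingRows_not_strictMono hk, rowSum_apply Q (Fin.tail (Fin.tail k)),
    eq_sub_iff_add_eq]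
  simp only [entryWeight_right, one_mul, hweight, evalHead_apply]

theorem sum_Icc_add_one_sub {M : Type*} [AddCommGroup M] (g : ℤ → M) {a b : ℤ} (h : a ≤ b) :
    ∑ x ∈ Finset.Icc a b, (g (x + 1) - g x) = g (b + 1) - g a := by
  induction b, h using Int.leInduction with
  | base => simp
  | succ b h ih =>
    rw [← Finset.insert_Icc_right_eq_Icc_add_one (by omega), Finset.sum_insert (by simp), ih]
    abel

theorem sum_entryWeight_mul_sub (Q : R) (g : ℤ → R) {a b : ℤ} (h : a < b) :
    ∑ x ∈ Finset.Icc a b, entryWeight Q a b x * (g (x + 1) - g x) =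
      (g (b + 1) - (1 - Q) * g b) - (g a - (1 - Q) * g (a + 1)) := by
  have hweight : ∀ x ∈ Finset.Icc a b, entryWeight Q a b x * (g (x + 1) - g x) =
      Q * (g (x + 1) - g x) + ((if x = a then (1 - Q) * (g (x + 1) - g x) else 0) +
        if x = b then (1 - Q) * (g (x + 1) - g x) else 0) := by
    intro x hx
    rw [Finset.mem_Icc] at hx
    rw [entryWeight]
    split_ifs <;> first | omega | ring
  rw [Finset.sum_congr rfl hweight, Finset.sum_add_distrib, ← Finset.mul_sum,
    sum_Icc_add_one_sub g h.le, Finset.sum_add_distrib, Finset.sum_ite_eq', Finset.sum_ite_eq',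
    if_pos (Finset.left_mem_Icc.2 h.le), if_pos (Finset.right_mem_Icc.2 h.le)]
  ring

theorem sum_entryWeight_mul_rowSum (Q : R) (k : Fin (n + 1) → ℤ) {a b : ℤ} (h : a < b)
    (f : (Fin (n + 1) → ℤ) → R) :
    ∑ x ∈ Finset.Icc a b, entryWeight Q a b x *
        rowSum Q k (evalHead x (shiftAction R (n + 1) (diffProd R (n + 1)) f)) =
      rowSum Q k (shiftAction R n (diffProd R n) (rightEdge Q b f)) -
        rowSum Q k (shiftAction R n (diffProd R n) (leftEdge Q a f)) := by
  simpa only [evalHead_shiftAction_diffProd, headDiff, rightEdge, leftEdge, map_sub,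
    LinearMap.sub_apply, LinearMap.smul_apply, map_smul, smul_eq_mul] using
    sum_entryWeight_mul_sub Q
      (fun x => rowSum Q k (shiftAction R n (diffProd R n) (evalHead x f))) h

theorem rowSum_shiftAction_diffProd_one (Q : R) {k : Fin 2 → ℤ} (hk : StrictMono k)
    (f : (Fin 1 → ℤ) → R) :
    rowSum Q k (shiftAction R 1 (diffProd R 1) f) =
      rowSum Q (Fin.tail k) (shiftAction R 0 (diffProd R 0) (rightEdge Q (k 1) f)) -
        rowSum Q (Fin.tail k) (shiftAction R 0 (diffProd R 0) (leftEdge Q (k 0) f)) := by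
  rw [rowSum_one, sum_entryWeight_mul_rowSum Q _ (hk Fin.zero_lt_one)]

theorem rowSum_shiftAction_diffProd_succ_succ (Q : R) {k : Fin (n + 3) → ℤ} (hk : StrictMono k)
    (f : (Fin (n + 2) → ℤ) → R) :
    rowSum Q k (shiftAction R (n + 2) (diffProd R (n + 2)) f) =
      rowSum Q (Fin.tail k) (shiftAction R (n + 1) (diffProd R (n + 1)) (rightEdge Q (k 1) f)) -
        rowSum Q (Fin.tail k) (shiftAction R (n + 1) (diffProd R (n + 1)) (leftEdge Q (k 0) f)) -
        rowSum Q (Fin.tail (Fin.tail k))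
          (shiftAction R n (diffProd R n) (headDiff (k 1) (headDiff (k 1) f))) := by
  rw [rowSum_succ_succ Q hk, sum_entryWeight_mul_rowSum Q _ (hk Fin.zero_lt_one),
    evalHead_shiftAction_diffProd, evalHead_shiftAction_diffProd]

/-- The alternating sum over `p` of the values at `k` without `k_p` of the function obtained by
applying `id - (1 - Q) E` in the variables before `k_p` and `E - (1 - Q) id` in those after it. -/
noncomputable def alternatingSum (Q : R) (k : Fin (n + 1) → ℤ) : ((Fin n → ℤ) → R) →ₗ[R] R :=
  ∑ p : Fin (n + 1), (-1 : R) ^ (p : ℕ) •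
    LinearMap.proj (p.removeNth k) ∘ₗ shiftAction R n (edgeProd Q p)

theorem alternatingSum_apply (Q : R) (k : Fin (n + 1) → ℤ) (f : (Fin n → ℤ) → R) :
    alternatingSum Q k f = ∑ p : Fin (n + 1), (-1 : R) ^ (p : ℕ) *
      shiftAction R n (edgeProd Q p) f (p.removeNth k) := by
  simp [alternatingSum]

theorem edgeProd_zero_succ (Q : R) :
    edgeProd Q (0 : Fin (n + 2)) = rename Fin.succ (edgeProd Q (0 : Fin (n + 1))) *
      rightEdgePoly Q 0 := by
  simp [edgeProd, rightEdgePoly, Fin.prod_univ_succ, mul_comm]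

theorem edgeProd_succ (Q : R) (p : Fin (n + 1)) :
    edgeProd Q p.succ = rename Fin.succ (edgeProd Q p) * leftEdgePoly Q 0 := by
  simp [edgeProd, leftEdgePoly, rightEdgePoly, Fin.prod_univ_succ, apply_ite (rename _), mul_comm,
    Fin.castSucc_lt_iff_succ_le]

theorem shiftAction_edgeProd_zero (Q : R) (f : (Fin (n + 1) → ℤ) → R) (k : Fin (n + 1) → ℤ) :
    shiftAction R (n + 1) (edgeProd Q 0) f k =
      shiftAction R n (edgeProd Q 0) (rightEdge Q (k 0) f) (Fin.tail k) := by
  rw [← evalHead_head_apply_tail (shiftAction R (n + 1) _ f) k, edgeProd_zero_succ,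
    evalHead_shiftAction_rename_succ_mul_rightEdgePoly]

theorem alternatingSum_succ (Q : R) (k : Fin (n + 2) → ℤ) (f : (Fin (n + 1) → ℤ) → R) :
    alternatingSum Q k f = shiftAction R (n + 1) (edgeProd Q 0) f (Fin.tail k) -
      alternatingSum Q (Fin.tail k) (leftEdge Q (k 0) f) := by
  have hterm (p : Fin (n + 1)) :
      shiftAction R (n + 1) (edgeProd Q p.succ) f (p.succ.removeNth k) =
        shiftAction R n (edgeProd Q p) (leftEdge Q (k 0) f) (p.removeNth (Fin.tail k)) := by
    have hremove : p.succ.removeNth k = Fin.cons (k 0) (p.removeNth (Fin.tail k)) := by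
      funext i
      cases i using Fin.cases <;> simp [Fin.removeNth_apply, Fin.tail]
    rw [edgeProd_succ, ← evalHead_shiftAction_rename_succ_mul_leftEdgePoly, hremove, evalHead_apply]
  rw [alternatingSum_apply, alternatingSum_apply, Fin.sum_univ_succ, sub_eq_add_neg,
    ← Finset.sum_neg_distrib]
  simp only [hterm, Fin.val_zero, pow_zero, one_mul, Fin.val_succ, pow_succ, mul_neg_one, neg_mul]
  rfl

/-- The correction term for rows that are not strictly increasing cancels the mixed boundary term
`leftEdge Q (k 1) (rightEdge Q (k 1) f)`. -/
theorem rowSum_shiftAction_diffProd (Q : R) : ∀ {n : ℕ} {k : Fin (n + 1) → ℤ}, StrictMono k →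
    ∀ {f : (Fin n → ℤ) → R}, f ∈ diagonalKernel Q n →
      rowSum Q k (shiftAction R n (diffProd R n) f) = alternatingSum Q k f
  | 0, k, _, f, _ => by
    rw [rowSum_zero Q k _ (Fin.removeNth 0 k), alternatingSum_apply, Fin.sum_univ_one]
    simp [diffProd, edgeProd]
  | 1, k, hk, f, hf => by
    rw [rowSum_shiftAction_diffProd_one Q hk,
      rowSum_shiftAction_diffProd Q (strictMono_tail hk) (leftEdge_mem_diagonalKernel hf _),
      alternatingSum_succ, shiftAction_edgeProd_zero, rowSum_zero Q _ _ (Fin.tail (Fin.tail k))]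
    simp [diffProd, edgeProd, Fin.tail]
  | n + 2, k, hk, f, hf => by
    have hk' := strictMono_tail hk
    rw [rowSum_shiftAction_diffProd_succ_succ Q hk,
      rowSum_shiftAction_diffProd Q hk' (rightEdge_mem_diagonalKernel hf _),
      rowSum_shiftAction_diffProd Q hk' (leftEdge_mem_diagonalKernel hf _),
      rowSum_shiftAction_diffProd Q (strictMono_tail hk')
        (headDiff_mem_diagonalKernel (headDiff_mem_diagonalKernel hf _) _),
      alternatingSum_succ Q (Fin.tail k), alternatingSum_succ Q k,
      shiftAction_edgeProd_zero Q f]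
    have hcancel := leftEdge_rightEdge_of_mem_diagonalKernel hf (k 1)
    simp only [Fin.tail, Fin.succ_zero_eq_one, hcancel, map_neg]
    ring

end InterlacingRows

section BinomialDeterminant

open MvPolynomial

variable {R : Type*} [CommRing R]

/-- The determinant of the binomial coefficients `k_i choose j + d`, for `0 ≤ j < n`. -/
noncomputable def chooseDet (R : Type*) [CommRing R] (d n : ℕ) (k : Fin n → ℤ) : R :=
  (Matrix.of fun j i : Fin n => ((Ring.choose (k i) ((j : ℕ) + d) : ℤ) : R)).det

theorem chooseDet_comp_perm (d : ℕ) {n : ℕ} (σ : Equiv.Perm (Fin n)) (k : Fin n → ℤ) :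
    chooseDet R d n (k ∘ σ) = Equiv.Perm.sign σ * chooseDet R d n k :=
  Matrix.det_permute' σ (Matrix.of fun j i : Fin n => ((Ring.choose (k i) ((j : ℕ) + d) : ℤ) : R))

theorem chooseDet_eq_zero_of_eq (d : ℕ) {n : ℕ} {i j : Fin n} (hij : i ≠ j) {k : Fin n → ℤ}
    (hk : k i = k j) : chooseDet R d n k = 0 :=
  Matrix.det_zero_of_column_eq hij fun _ => by simp only [Matrix.of_apply, hk]

theorem chooseDet_zero_succ (n : ℕ) :
    chooseDet R 0 (n + 1) =
      ∑ p : Fin (n + 1), (-1 : R) ^ (p : ℕ) • omitVar p (chooseDet R 1 n) := by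
  funext k
  rw [chooseDet, Matrix.det_succ_row_zero, Finset.sum_apply]
  refine Finset.sum_congr rfl fun p _ => ?_
  simp only [Matrix.of_apply, Fin.val_zero, add_zero, Ring.choose_zero_right, Int.cast_one, mul_one]
  rfl

theorem shiftAction_diffProd_prod {n : ℕ} (g : Fin n → ℤ → R) :
    shiftAction R n (diffProd R n) (fun k => ∏ i, g i (k i)) =
      fun k => ∏ i, (g i (k i + 1) - g i (k i)) := by
  induction n with
  | zero => simp [diffProd]
  | succ n ih =>
    funext k
    have hhead : headDiff (k 0) (fun l => ∏ i, g i (l i)) =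
        (g 0 (k 0 + 1) - g 0 (k 0)) • fun l : Fin n → ℤ => ∏ i, g i.succ (l i) := by
      funext l
      simp [headDiff, evalHead_apply, Fin.prod_univ_succ, sub_mul]
    rw [← evalHead_head_apply_tail (shiftAction R (n + 1) _ _) k, evalHead_shiftAction_diffProd,
      hhead, map_smul, ih fun i => g i.succ, Fin.prod_univ_succ]
    rfl

theorem shiftAction_diffProd_chooseDet (d n : ℕ) :
    shiftAction R n (diffProd R n) (chooseDet R (d + 1) n) = chooseDet R d n := by
  have hdet (d : ℕ) : chooseDet R d n = ∑ σ : Equiv.Perm (Fin n), ((Equiv.Perm.sign σ : ℤ) : R) •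
      fun k : Fin n → ℤ => ∏ i, ((Ring.choose (k i) ((σ i : ℕ) + d) : ℤ) : R) := by
    funext k
    rw [chooseDet, Matrix.det_apply', Finset.sum_apply]
    rfl
  have hpascal (x : ℤ) (j : ℕ) : ((Ring.choose (x + 1) (j + (d + 1)) : ℤ) : R) -
      (Ring.choose x (j + (d + 1)) : ℤ) = (Ring.choose x (j + d) : ℤ) := by
    rw [← add_assoc, Ring.choose_succ_succ, Int.cast_add, add_sub_cancel_right]
  rw [hdet, hdet, map_sum]
  refine Finset.sum_congr rfl fun σ _ => ?_
  rw [map_smul, shiftAction_diffProd_prod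
    fun i x => ((Ring.choose x ((σ i : ℕ) + (d + 1)) : ℤ) : R)]
  simp only [hpascal]

theorem map_chooseDet {S : Type*} [CommRing S] (φ : R →+* S) (d : ℕ) {n : ℕ} (k : Fin n → ℤ) :
    φ (chooseDet R d n k) = chooseDet S d n k := by
  rw [chooseDet, RingHom.map_det, chooseDet]
  congr 1
  ext
  simp

theorem chooseDet_val (n : ℕ) : chooseDet R 0 n (fun i => ((i : ℕ) : ℤ)) = 1 := by
  rw [chooseDet, Matrix.det_of_isUpperTriangular]
  · simp [Ring.choose_natCast]
  · intro i j hij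
    have hlt : (j : ℕ) < i := hij
    simp [Ring.choose_natCast, Nat.choose_eq_zero_of_lt hlt]

theorem prod_factorial_mul_chooseDet_int {n : ℕ} (k : Fin n → ℤ) :
    (∏ j : Fin n, ((j : ℕ).factorial : ℤ)) * chooseDet ℤ 0 n k = (Matrix.vandermonde k).det := by
  rw [Matrix.det_eval_matrixOfPolynomials_eq_det_vandermonde k (fun j => descPochhammer ℤ j)
    (fun j => descPochhammer_natDegree ℤ j) (fun j => monic_descPochhammer ℤ j), chooseDet,
    ← Matrix.det_transpose, ← Matrix.det_mul_row]
  congr 1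
  ext i j
  rw [Matrix.of_apply, Matrix.transpose_apply, Matrix.of_apply, Matrix.of_apply, add_zero,
    Int.cast_id, Polynomial.eval_eq_smeval, Ring.descPochhammer_eq_factorial_smul_choose,
    nsmul_eq_mul]

theorem prod_factorial_mul_chooseDet {n : ℕ} (k : Fin n → ℤ) :
    (∏ j : Fin n, ((j : ℕ).factorial : R)) * chooseDet R 0 n k =
      ∏ p : Fin n × Fin n with p.1 < p.2, ((k p.2 : R) - k p.1) := by
  have hint := congrArg (Int.castRingHom R) (prod_factorial_mul_chooseDet_int k)
  rw [Matrix.det_vandermonde, map_mul, map_chooseDet] at hint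
  rw [Finset.prod_finset_product' _ Finset.univ Finset.Ioi (by simp)
    (f := fun i j => (k j : R) - k i)]
  simpa using hint

theorem vandermondeQuotient_eq_chooseDet (R : Type*) [CommRing R] [Algebra ℚ R] (n : ℕ) :
    vandermondeQuotient R n = chooseDet R 0 n := by
  funext k
  have hden := prod_factorial_mul_chooseDet (R := ℚ) fun i : Fin n => ((i : ℕ) : ℤ)
  simp only [chooseDet_val, mul_one, Int.cast_natCast] at hden
  have hne : ∏ j : Fin n, ((j : ℕ).factorial : ℚ) ≠ 0 :=
    Finset.prod_ne_zero_iff.2 fun j _ => Nat.cast_ne_zero.2 (j : ℕ).factorial_ne_zero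
  rw [vandermondeQuotient, ← map_prod, Finset.prod_div_distrib, ← hden,
    ← prod_factorial_mul_chooseDet, mul_div_cancel_left₀ _ hne, map_chooseDet]

theorem shiftAction_pairProd_chooseDet_mem_diagonalKernel (Q : R) (d n : ℕ) :
    shiftAction R n (pairProd Q n) (chooseDet R d n) ∈ diagonalKernel Q n := by
  intro i j hij l hl
  have hne : i ≠ j := fun h => by rw [h] at hij; omega
  rw [← shiftAction_pairPoly, ← Module.End.mul_apply, ← map_mul]
  refine shiftAction_apply_eq_zero_of_swap (rename_swap_pairPoly_mul_pairProd Q hij)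
    (fun k => ?_) (fun _ => chooseDet_eq_zero_of_eq d hne) hl
  rw [chooseDet_comp_perm, Equiv.Perm.sign_swap hne]
  simp

theorem alternatingSum_pairProd_chooseDet (Q : R) {n : ℕ} (k : Fin (n + 1) → ℤ) :
    alternatingSum Q k (shiftAction R n (pairProd Q n) (chooseDet R 1 n)) =
      shiftAction R (n + 1) (pairProd Q (n + 1)) (chooseDet R 0 (n + 1)) k := by
  rw [alternatingSum_apply, chooseDet_zero_succ, map_sum, Finset.sum_apply]
  refine Finset.sum_congr rfl fun p _ => ?_
  rw [map_smul, shiftAction_omitVar, aeval_insertNth_one_pairProd, map_mul, Module.End.mul_apply]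
  rfl

end BinomialDeterminant

namespace MonotoneTriangle

variable {R : Type*} [CommRing R] {n : ℕ}

/-- The triangle above the bottom row. -/
def removeBottom (T : MonotoneTriangle (n + 1)) : MonotoneTriangle n where
  entry i j := T.entry (i + 1) (j + 1)
  northeast i j hi hj := T.northeast (i + 1) (j + 1) (by omega) (by omega)
  southeast i j hi hj := T.southeast (i + 1) (j + 1) (by omega) (by omega)
  row_strict i j hi hj := T.row_strict (i + 1) (j + 1) (by omega) (by omega)
  zeros i j h := T.zeros (i + 1) (j + 1) (by omega)

/-- The entries of the triangle `T` with the row `k` put below it. -/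
def addBottomEntry (T : MonotoneTriangle n) (k : Fin (n + 1) → ℤ) : ℕ → ℕ → ℤ
  | 0, j => if h : j < n + 1 then k ⟨j, h⟩ else 0
  | _ + 1, 0 => 0
  | i + 1, j + 1 => T.entry i j

/-- The triangle `T` with the row `k` put below it. -/
def addBottom (T : MonotoneTriangle n) (k : Fin (n + 1) → ℤ) (hk : StrictMono k)
    (h : T.bottomRow ∈ interlacingRows k) : MonotoneTriangle (n + 1) where
  entry := addBottomEntry T k
  northeast
    | 0, j, _, hj => by
      have hle : k ⟨j, by omega⟩ ≤ T.entry 0 j := ((mem_interlacingRows.1 h).1 ⟨j, by omega⟩).1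
      simpa [addBottomEntry, show j < n + 1 by omega] using hle
    | i + 1, 0, hi, _ => by omega
    | i + 1, j + 1, hi, hj => T.northeast i j (by omega) (by omega)
  southeast
    | 0, 0, hi, _ => by omega
    | 0, j + 1, _, hj => by
      have hle : T.entry 0 j ≤ k ⟨j + 1, hj⟩ := ((mem_interlacingRows.1 h).1 ⟨j, by omega⟩).2
      simpa [addBottomEntry, show j < n by omega] using hle
    | i + 1, 0, hi, _ => by omega
    | i + 1, j + 1, hi, hj => T.southeast i j (by omega) (by omega)
  row_strict
    | 0, j, _, hj => by
      have hlt : k ⟨j, by omega⟩ < k ⟨j + 1, hj⟩ := hk (Fin.mk_lt_mk.2 j.lt_succ_self)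
      simpa [addBottomEntry, show j < n + 1 by omega, show j < n by omega] using hlt
    | i + 1, 0, hi, _ => by omega
    | i + 1, j + 1, hi, hj => T.row_strict i j (by omega) (by omega)
  zeros
    | 0, j, hj => dif_neg fun h => hj ⟨j.zero_le, h⟩
    | i + 1, 0, _ => rfl
    | i + 1, j + 1, hj => T.zeros i j (by omega)

theorem bottomRow_addBottom (T : MonotoneTriangle n) (k : Fin (n + 1) → ℤ)
    (hk : StrictMono k) (h : T.bottomRow ∈ interlacingRows k) :
    (T.addBottom k hk h).bottomRow = k :=
  funext fun j => dif_pos j.2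

theorem mem_withBottomRow {k : Fin n → ℤ} {T : MonotoneTriangle n} :
    T ∈ withBottomRow k ↔ T.bottomRow = k := by
  simp [withBottomRow]

theorem ext_removeBottom {T T' : MonotoneTriangle (n + 1)} (hrow : T.bottomRow = T'.bottomRow)
    (h : T.removeBottom = T'.removeBottom) : T = T' := by
  ext i j
  by_cases hij : i ≤ j ∧ j < n + 1
  · match i, j with
    | 0, j => exact congrFun hrow ⟨j, hij.2⟩
    | i + 1, 0 => omega
    | i + 1, j + 1 => exact congrArg (fun S => S.entry i j) h
  · rw [T.zeros i j hij, T'.zeros i j hij]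

theorem bottomRow_removeBottom_mem_interlacingRows (T : MonotoneTriangle (n + 1)) :
    T.removeBottom.bottomRow ∈ interlacingRows T.bottomRow := by
  refine mem_interlacingRows.2 ⟨fun i => ⟨T.northeast 0 i (by omega) (by omega),
    T.southeast 0 (i + 1) (by omega) (by omega)⟩, ?_⟩
  cases n with
  | zero => exact Subsingleton.strictMono _
  | succ n =>
    exact Fin.strictMono_iff_lt_succ.2 fun i => T.row_strict 1 (i + 1) (by omega) (by omega)

theorem rowWeight_bottomRow_removeBottom (Q : R) (T : MonotoneTriangle (n + 1)) :
    rowWeight Q T.bottomRow T.removeBottom.bottomRow =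
      Q ^ ∑ j ∈ Finset.range n,
        if T.entry 0 j < T.entry 1 (j + 1) ∧ T.entry 1 (j + 1) < T.entry 0 (j + 1)
        then 1 else 0 := by
  rw [← Finset.prod_pow_eq_pow_sum, Finset.prod_range, rowWeight]
  refine Finset.prod_congr rfl fun i _ => ?_
  rw [entryWeight, pow_ite, pow_one, pow_zero]
  rfl

theorem numStrictlyBetween_succ (T : MonotoneTriangle (n + 1)) :
    T.numStrictlyBetween = (∑ j ∈ Finset.range n,
        if T.entry 0 j < T.entry 1 (j + 1) ∧ T.entry 1 (j + 1) < T.entry 0 (j + 1)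
        then 1 else 0) + T.removeBottom.numStrictlyBetween := by
  rw [numStrictlyBetween, numStrictlyBetween, Finset.card_filter, Finset.card_filter,
    Finset.sum_product, Finset.sum_product, Finset.sum_range_succ', add_comm]
  congr 1
  · rw [Finset.sum_range_succ, if_neg (by omega), add_zero]
    refine Finset.sum_congr rfl fun j hj => ?_
    simp [Finset.mem_range.1 hj]
  · refine Finset.sum_congr rfl fun i _ => ?_
    rw [Finset.sum_range_succ', if_neg (by simp), add_zero]
    exact Finset.sum_congr rfl fun j _ => if_congr (by simp [removeBottom]) rfl rfl

theorem generatingFunction_succ (Q : R) {k : Fin (n + 1) → ℤ} (hk : StrictMono k) :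
    generatingFunction Q k = rowSum Q k (generatingFunction Q) := by
  have hmaps : ∀ T ∈ withBottomRow k, T.removeBottom.bottomRow ∈ interlacingRows k :=
    fun T hT => mem_withBottomRow.1 hT ▸ T.bottomRow_removeBottom_mem_interlacingRows
  rw [generatingFunction, ← Finset.sum_fiberwise_of_maps_to hmaps, rowSum_apply]
  refine Finset.sum_congr rfl fun l hl => ?_
  rw [generatingFunction, Finset.mul_sum]
  refine Finset.sum_bij' (fun T _ => T.removeBottom)
    (fun T hT => T.addBottom k hk ((mem_withBottomRow.1 hT).symm ▸ hl))
    (fun T hT => mem_withBottomRow.2 (Finset.mem_filter.1 hT).2)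
    (fun T hT => Finset.mem_filter.2
      ⟨mem_withBottomRow.2 (bottomRow_addBottom ..), mem_withBottomRow.1 hT⟩)
    (fun T hT => ext_removeBottom ?_ rfl) (fun _ _ => rfl) fun T hT => ?_
  · rw [bottomRow_addBottom, mem_withBottomRow.1 (Finset.mem_filter.1 hT).1]
  · obtain ⟨hbottom, rfl⟩ := Finset.mem_filter.1 hT
    rw [numStrictlyBetween_succ, pow_add, ← rowWeight_bottomRow_removeBottom,
      mem_withBottomRow.1 hbottom]

theorem generatingFunction_zero (Q : R) (k : Fin 0 → ℤ) : generatingFunction Q k = 1 := by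
  let T₀ : MonotoneTriangle 0 := ⟨fun _ _ => 0, by simp, by simp, by simp, by simp⟩
  have hT₀ (T : MonotoneTriangle 0) : T = T₀ := by
    ext i j
    exact T.zeros i j (by simp)
  have hsingleton : withBottomRow k = {T₀} := by
    ext T
    simp only [mem_withBottomRow, Finset.mem_singleton, hT₀ T, iff_true]
    exact Subsingleton.elim _ _
  simp [generatingFunction, hsingleton, numStrictlyBetween]

end MonotoneTriangle

theorem theorem1_general {R : Type*} [CommRing R] (Q : R) (n : ℕ) (k : Fin n → ℤ)
    (hk : StrictMono k) :
    MonotoneTriangle.generatingFunction Q k = operatorProduct Q n (chooseDet R 0 n) k := by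
  rw [← shiftAction_pairProd]
  induction n with
  | zero => simp [MonotoneTriangle.generatingFunction_zero, pairProd, chooseDet]
  | succ n ih =>
    have hcomm : shiftAction R n (pairProd Q n) (chooseDet R 0 n) = shiftAction R n (diffProd R n)
        (shiftAction R n (pairProd Q n) (chooseDet R 1 n)) := by
      rw [← Module.End.mul_apply, ← map_mul, mul_comm, map_mul, Module.End.mul_apply,
        shiftAction_diffProd_chooseDet]
    calc MonotoneTriangle.generatingFunction Q k
        = rowSum Q k (MonotoneTriangle.generatingFunction Q) :=
          MonotoneTriangle.generatingFunction_succ Q hk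
      _ = rowSum Q k (shiftAction R n (pairProd Q n) (chooseDet R 0 n)) := rowSum_congr Q k ih
      _ = alternatingSum Q k (shiftAction R n (pairProd Q n) (chooseDet R 1 n)) := by
          rw [hcomm, rowSum_shiftAction_diffProd Q hk
            (shiftAction_pairProd_chooseDet_mem_diagonalKernel Q 1 n)]
      _ = shiftAction R (n + 1) (pairProd Q (n + 1)) (chooseDet R 0 (n + 1)) k :=
          alternatingSum_pairProd_chooseDet Q k

theorem theorem1 {R : Type*} [CommRing R] [Algebra ℚ R] (Q : R) (n : ℕ) (k : Fin n → ℤ)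
    (hk : StrictMono k) :
    MonotoneTriangle.generatingFunction Q k =
      operatorProduct Q n (vandermondeQuotient R n) k := by
  rw [vandermondeQuotient_eq_chooseDet]
  exact theorem1_general Q n k hk
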